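/- Rings are associative but need not have an identity. A ring $R$ is called $s$-unital if $r\in Rr$ and $r\in rR$ for every $r\in R$, and a ring $S$ is called prime if there are no nonzero two-sided ideals $I,J$ of $S$ with $IJ=\{0\}$. A groupoid $G$ is a small category in which every morphism is invertible; $G_0$ is its set of objects, and for $e\in G_0$ the isotropy group $G_e^e$ is the group of all morphisms from $e$ to $e$. The groupoid $G$ is connected if for all $e,f\in G_0$ there is a morphism from $e$ to $f$. The groupoid ring $R[G]$ consists of the finite formal sums $\sum_g a_g\delta_g$ with $a_g\in R$ and $g$ running through the morphisms of $G$, with the biadditive multiplication determined by $a\delta_g\cdot b\delta_h=ab\,\delta_{gh}$ if $g,h$ are composable, and $0$ otherwise; for a group this is the group ring. Let $R$ be a nonzero $s$-unital ring and let $G$ be a non-empty groupoid. The following assertions are equivalent: (i) the groupoid ring $R[G]$ is prime; (ii) $G$ is connected and there is some $e\in G_0$ such that $R[G_e^e]$ is prime; (iii) $G$ is connected and, for every $e\in G_0$, $R[G_e^e]$ is prime; (iv) $G$ is connected, $R$ is prime, and there is some $e\in G_0$ such that $G_e^e$ has no non-trivial finite normal subgroup; (v) $G$ is connected, $R$ is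 prime and, for every $e\in G_0$, $G_e^e$ has no non-trivial finite normal subgroup. -/

import Mathlib

open CategoryTheory

universe u v w

/-- A (not necessarily unital) ring `R` is `s`-unital if `r ∈ R r` and `r ∈ r R` for all `r`. -/
def IsSUnitalRing (R : Type*) [NonUnitalRing R] : Prop :=
  ∀ r : R, (∃ a : R, a * r = r) ∧ (∃ b : R, r * b = r)

/-- A (not necessarily unital) ring `S` is prime if there are no nonzero two-sided ideals `I`, `J`
with `I J = 0`. (The ideal `I J` consists of the finite sums of products `a * b` with `a ∈ I` and
`b ∈ J`, so it is zero exactly when all these products are.) -/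
def IsPrimeNonUnitalRing (S : Type*) [NonUnitalRing S] : Prop :=
  ¬ ∃ I J : TwoSidedIdeal S, I ≠ ⊥ ∧ J ≠ ⊥ ∧ ∀ a ∈ I, ∀ b ∈ J, a * b = 0

/-- A groupoid is connected if there is a morphism between any two objects. -/
def GroupoidConnected (G : Type u) [Groupoid.{v} G] : Prop :=
  ∀ e f : G, Nonempty (e ⟶ f)

/-- A group has no non-trivial finite normal subgroup. -/
def NoNontrivialFiniteNormalSubgroup (H : Type*) [Group H] : Prop :=
  ∀ N : Subgroup H, N.Normal → Finite N → N = ⊥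

noncomputable section

/-- The set of all morphisms of a groupoid. -/
structure GroupoidMor (G : Type u) [Groupoid.{v} G] where
  /-- The source (domain). -/
  s : G
  /-- The range (codomain). -/
  r : G
  /-- The morphism itself. -/
  hom : s ⟶ r

namespace GroupoidMor

variable {G : Type u} [Groupoid.{v} G]

/-- The product `g h` ("first `h`, then `g`") of a composable pair, that is, `s(g) = r(h)`. -/
def comp (g h : GroupoidMor G) (p : g.s = h.r) : GroupoidMor G :=
  ⟨h.s, g.r, h.hom ≫ eqToHom p.symm ≫ g.hom⟩

theorem comp_assoc (g h k : GroupoidMor G) (p : g.s = h.r) (q : h.s = k.r) :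
    (g.comp h p).comp k q = g.comp (h.comp k q) p := by
  simp [comp]

end GroupoidMor

/-- The groupoid ring `R[G]`: finite formal sums `∑ a_g δ_g` over the morphisms `g` of `G`. -/
def GroupoidRing (R : Type w) [NonUnitalRing R] (G : Type u) [Groupoid.{v} G] :
    Type (max u v w) :=
  GroupoidMor G →₀ R

namespace GroupoidRing

variable {R : Type w} [NonUnitalRing R] {G : Type u} [Groupoid.{v} G]

instance : AddCommGroup (GroupoidRing R G) :=
  inferInstanceAs (AddCommGroup (GroupoidMor G →₀ R))

/-- The element `a δ_g`. -/
def single (g : GroupoidMor G) (a : R) : GroupoidRing R G := Finsupp.single g a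

open Classical in
/-- The product `a δ_g · b δ_h`: it is `ab δ_{gh}` if `g`, `h` are composable and `0` otherwise. -/
def mulSingle (g h : GroupoidMor G) (a b : R) : GroupoidRing R G :=
  if p : g.s = h.r then single (g.comp h p) (a * b) else 0

/-- The biadditive extension of `a δ_g · b δ_h`. -/
instance : Mul (GroupoidRing R G) :=
  ⟨fun x y => Finsupp.sum x fun g a => Finsupp.sum y fun h b => mulSingle g h a b⟩

theorem single_zero (g : GroupoidMor G) : single g (0 : R) = 0 := Finsupp.single_zero g

theorem single_add (g : GroupoidMor G) (a b : R) :
    single g (a + b) = single g a + single g b := Finsupp.single_add g a b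

theorem mulSingle_zero_left (g h : GroupoidMor G) (b : R) : mulSingle g h 0 b = 0 := by
  unfold mulSingle; split_ifs <;> simp [single_zero]

theorem mulSingle_zero_right (g h : GroupoidMor G) (a : R) : mulSingle g h a 0 = 0 := by
  unfold mulSingle; split_ifs <;> simp [single_zero]

theorem mulSingle_add_left (g h : GroupoidMor G) (a a' b : R) :
    mulSingle g h (a + a') b = mulSingle g h a b + mulSingle g h a' b := by
  unfold mulSingle; split_ifs <;> simp [add_mul, single_add]

theorem mulSingle_add_right (g h : GroupoidMor G) (a b b' : R) :
    mulSingle g h a (b + b') = mulSingle g h a b + mulSingle g h a b' := by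
  unfold mulSingle; split_ifs <;> simp [mul_add, single_add]

theorem mul_def (x y : GroupoidRing R G) :
    x * y = Finsupp.sum x fun g a => Finsupp.sum y fun h b => mulSingle g h a b := rfl

protected theorem zero_mul (x : GroupoidRing R G) : 0 * x = 0 := Finsupp.sum_zero_index

protected theorem mul_zero (x : GroupoidRing R G) : x * 0 = 0 :=
  Finset.sum_eq_zero fun _ _ => Finsupp.sum_zero_index

protected theorem add_mul (x y z : GroupoidRing R G) : (x + y) * z = x * z + y * z := by
  classical
  refine Finsupp.sum_add_index' (fun g => ?_) (fun g a a' => ?_)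
  · exact Finset.sum_eq_zero fun h _ => mulSingle_zero_left g h _
  · exact (Finset.sum_congr rfl fun h _ => mulSingle_add_left g h a a' _).trans
      Finset.sum_add_distrib

protected theorem mul_add (x y z : GroupoidRing R G) : x * (y + z) = x * y + x * z := by
  classical
  refine (Finset.sum_congr rfl fun g _ => ?_).trans Finset.sum_add_distrib
  exact Finsupp.sum_add_index' (fun h => mulSingle_zero_right g h _)
    (fun h b b' => mulSingle_add_right g h _ b b')

theorem single_mul_single (g h : GroupoidMor G) (a b : R) :
    single g a * single h b = mulSingle g h a b := by
  refine (Finsupp.sum_single_index ?_).trans (Finsupp.sum_single_index ?_)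
  · exact Finset.sum_eq_zero fun k _ => mulSingle_zero_left g k _
  · exact mulSingle_zero_right g h a

theorem single_mul_single_of_eq (g h : GroupoidMor G) (p : g.s = h.r) (a b : R) :
    single g a * single h b = single (g.comp h p) (a * b) := by
  rw [single_mul_single, mulSingle, dif_pos p]

theorem single_mul_single_of_ne (g h : GroupoidMor G) (p : ¬ g.s = h.r) (a b : R) :
    single g a * single h b = 0 := by
  rw [single_mul_single, mulSingle, dif_neg p]

protected theorem induction {P : GroupoidRing R G → Prop} (x : GroupoidRing R G) (h0 : P 0)
    (hadd : ∀ y z, P y → P z → P (y + z)) (hs : ∀ g a, P (single g a)) : P x :=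
  Finsupp.induction_linear x h0 hadd hs

protected theorem mul_assoc (x y z : GroupoidRing R G) : x * y * z = x * (y * z) := by
  induction x using GroupoidRing.induction with
  | h0 => simp only [GroupoidRing.zero_mul]
  | hadd x x' hx hx' => simp only [GroupoidRing.add_mul, hx, hx']
  | hs g a =>
  induction y using GroupoidRing.induction with
  | h0 => simp only [GroupoidRing.zero_mul, GroupoidRing.mul_zero]
  | hadd y y' hy hy' => simp only [GroupoidRing.add_mul, GroupoidRing.mul_add, hy, hy']
  | hs h b =>
  induction z using GroupoidRing.induction with
  | h0 => simp only [GroupoidRing.mul_zero]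
  | hadd z z' hz hz' => simp only [GroupoidRing.mul_add, hz, hz']
  | hs k c =>
  by_cases p : g.s = h.r
  · by_cases q : h.s = k.r
    · rw [single_mul_single_of_eq g h p, single_mul_single_of_eq h k q,
        single_mul_single_of_eq (g.comp h p) k q, single_mul_single_of_eq g (h.comp k q) p,
        GroupoidMor.comp_assoc, mul_assoc]
    · rw [single_mul_single_of_eq g h p, single_mul_single_of_ne h k q,
        single_mul_single_of_ne (g.comp h p) k q, GroupoidRing.mul_zero]
  · by_cases q : h.s = k.r
    · rw [single_mul_single_of_ne g h p, single_mul_single_of_eq h k q,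
        single_mul_single_of_ne g (h.comp k q) p, GroupoidRing.zero_mul]
    · rw [single_mul_single_of_ne g h p, single_mul_single_of_ne h k q,
        GroupoidRing.zero_mul, GroupoidRing.mul_zero]

instance : NonUnitalRing (GroupoidRing R G) where
  left_distrib := GroupoidRing.mul_add
  right_distrib := GroupoidRing.add_mul
  zero_mul := GroupoidRing.zero_mul
  mul_zero := GroupoidRing.mul_zero
  mul_assoc := GroupoidRing.mul_assoc

end GroupoidRing

/-- The group ring `R[H]` of a group `H` over a (not necessarily unital) ring `R`: finite formal
sums `∑ a_h δ_h` over the elements `h` of `H`. (`MonoidAlgebra` needs unital coefficients.) -/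
def NonUnitalGroupRing (R : Type w) [NonUnitalRing R] (H : Type v) [Group H] : Type (max v w) :=
  H →₀ R

namespace NonUnitalGroupRing

variable {R : Type w} [NonUnitalRing R] {H : Type v} [Group H]

instance : AddCommGroup (NonUnitalGroupRing R H) :=
  inferInstanceAs (AddCommGroup (H →₀ R))

/-- The element `a δ_h`. -/
def single (h : H) (a : R) : NonUnitalGroupRing R H := Finsupp.single h a

/-- The biadditive extension of `a δ_g · b δ_h = ab δ_{gh}`. -/
instance : Mul (NonUnitalGroupRing R H) :=
  ⟨fun x y => Finsupp.sum x fun g a => Finsupp.sum y fun h b => single (g * h) (a * b)⟩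

theorem single_zero (h : H) : single h (0 : R) = 0 := Finsupp.single_zero h

theorem single_add (h : H) (a b : R) :
    single h (a + b) = single h a + single h b := Finsupp.single_add h a b

theorem mul_def (x y : NonUnitalGroupRing R H) :
    x * y = Finsupp.sum x fun g a => Finsupp.sum y fun h b => single (g * h) (a * b) := rfl

protected theorem zero_mul (x : NonUnitalGroupRing R H) : 0 * x = 0 := Finsupp.sum_zero_index

protected theorem mul_zero (x : NonUnitalGroupRing R H) : x * 0 = 0 :=
  Finset.sum_eq_zero fun _ _ => Finsupp.sum_zero_index

protected theorem add_mul (x y z : NonUnitalGroupRing R H) : (x + y) * z = x * z + y * z := by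
  classical
  refine Finsupp.sum_add_index' (fun g => ?_) (fun g a a' => ?_)
  · exact Finset.sum_eq_zero fun h _ => by simp only [zero_mul, single_zero]
  · exact (Finset.sum_congr rfl fun h _ => by simp only [add_mul, single_add]).trans
      Finset.sum_add_distrib

protected theorem mul_add (x y z : NonUnitalGroupRing R H) : x * (y + z) = x * y + x * z := by
  classical
  refine (Finset.sum_congr rfl fun g _ => ?_).trans Finset.sum_add_distrib
  exact Finsupp.sum_add_index' (fun h => by simp only [mul_zero, single_zero])
    (fun h b b' => by simp only [mul_add, single_add])

theorem single_mul_single (g h : H) (a b : R) :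
    single g a * single h b = single (g * h) (a * b) := by
  refine (Finsupp.sum_single_index ?_).trans (Finsupp.sum_single_index ?_)
  · exact Finset.sum_eq_zero fun k _ => by simp only [zero_mul, single_zero]
  · simp only [mul_zero, single_zero]

protected theorem induction {P : NonUnitalGroupRing R H → Prop} (x : NonUnitalGroupRing R H)
    (h0 : P 0) (hadd : ∀ y z, P y → P z → P (y + z)) (hs : ∀ h a, P (single h a)) : P x :=
  Finsupp.induction_linear x h0 hadd hs

protected theorem mul_assoc (x y z : NonUnitalGroupRing R H) : x * y * z = x * (y * z) := by
  induction x using NonUnitalGroupRing.induction with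
  | h0 => simp only [NonUnitalGroupRing.zero_mul]
  | hadd x x' hx hx' => simp only [NonUnitalGroupRing.add_mul, hx, hx']
  | hs g a =>
  induction y using NonUnitalGroupRing.induction with
  | h0 => simp only [NonUnitalGroupRing.zero_mul, NonUnitalGroupRing.mul_zero]
  | hadd y y' hy hy' =>
    simp only [NonUnitalGroupRing.add_mul, NonUnitalGroupRing.mul_add, hy, hy']
  | hs h b =>
  induction z using NonUnitalGroupRing.induction with
  | h0 => simp only [NonUnitalGroupRing.mul_zero]
  | hadd z z' hz hz' => simp only [NonUnitalGroupRing.mul_add, hz, hz']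
  | hs k c => simp only [single_mul_single, mul_assoc]

instance : NonUnitalRing (NonUnitalGroupRing R H) where
  left_distrib := NonUnitalGroupRing.mul_add
  right_distrib := NonUnitalGroupRing.add_mul
  zero_mul := NonUnitalGroupRing.zero_mul
  mul_zero := NonUnitalGroupRing.mul_zero
  mul_assoc := NonUnitalGroupRing.mul_assoc

end NonUnitalGroupRing

end

/-- The isotropy group `G_e^e` of all morphisms from `e` to `e`, with the product `g h` being
"first `h`, then `g`". -/
abbrev Isotropy {G : Type u} [Groupoid.{v} G] (e : G) : Type v := End e

/-!
Annihilator ideals show that primeness of a ring can be tested on elements: `a S b = 0` must force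
`a = 0` or `b = 0`. If `G` is connected and `R` is prime, then any nonzero `x` in `R[G]` becomes a
nonzero element of a prescribed isotropy ring after multiplication on both sides by suitable
elements `u δ_p` and `v δ_q`, so `R[G]` is prime as soon as one isotropy ring is.

For a group `H` this is Connell's theorem, with Passman's argument for the hard direction. Let
`α R[H] β = 0` and let `Δ` be the FC centre of `H`. By B. H. Neumann's lemma on coset coverings,
there is an element of `H` that commutes with finitely many given elements of `Δ` and conjugates
finitely many given elements outside `Δ` away from a given finite set. Inserting it between `α` and
`β` shows that the parts of `α` and `β` on single cosets of `Δ` annihilate each other. If `H` has no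
nontrivial finite normal subgroup, then `Δ` is torsion-free by Dietzmann's lemma and abelian by
Schur's theorem, hence has unique products, and a unique product of support elements contradicts
the primeness of `R`.
-/

section PrimeRings

variable {S : Type*} [NonUnitalRing S]

/-- The left annihilator `{x | x A = 0}` of a set `A` stable under left multiplication, which is a
two-sided ideal. -/
def leftAnnihilatorIdeal (A : Set S) (hA : ∀ s, ∀ y ∈ A, s * y ∈ A) : TwoSidedIdeal S :=
  TwoSidedIdeal.mk' {x | ∀ y ∈ A, x * y = 0}
    (fun y _ => zero_mul y)
    (fun hx hx' y hy => by rw [add_mul, hx y hy, hx' y hy, add_zero])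
    (fun hx y hy => by rw [neg_mul, hx y hy, neg_zero])
    (fun hx y hy => by rw [mul_assoc, hx y hy, mul_zero])
    (fun hx y hy => by rw [mul_assoc, hx _ (hA _ y hy)])

/-- The right annihilator `{y | A y = 0}` of a set `A` stable under right multiplication, which is
a two-sided ideal. -/
def rightAnnihilatorIdeal (A : Set S) (hA : ∀ s, ∀ x ∈ A, x * s ∈ A) : TwoSidedIdeal S :=
  TwoSidedIdeal.mk' {y | ∀ x ∈ A, x * y = 0}
    (fun x _ => mul_zero x)
    (fun hy hy' x hx => by rw [mul_add, hy x hx, hy' x hx, add_zero])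
    (fun hy x hx => by rw [mul_neg, hy x hx, neg_zero])
    (fun hy x hx => by rw [← mul_assoc, hy _ (hA _ x hx)])
    (fun hy x hx => by rw [← mul_assoc, hy x hx, zero_mul])

theorem mem_leftAnnihilatorIdeal {A : Set S} {hA : ∀ s, ∀ y ∈ A, s * y ∈ A} {x : S} :
    x ∈ leftAnnihilatorIdeal A hA ↔ ∀ y ∈ A, x * y = 0 :=
  TwoSidedIdeal.mem_mk' ..

theorem mem_rightAnnihilatorIdeal {A : Set S} {hA : ∀ s, ∀ x ∈ A, x * s ∈ A} {y : S} :
    y ∈ rightAnnihilatorIdeal A hA ↔ ∀ x ∈ A, x * y = 0 :=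
  TwoSidedIdeal.mem_mk' ..

namespace IsPrimeNonUnitalRing

theorem eq_bot_or_eq_bot (hS : IsPrimeNonUnitalRing S) {I J : TwoSidedIdeal S}
    (hIJ : ∀ a ∈ I, ∀ b ∈ J, a * b = 0) : I = ⊥ ∨ J = ⊥ := by
  by_contra! hne
  exact hS ⟨I, J, hne.1, hne.2, hIJ⟩

theorem exists_mul_ne_zero (hS : IsPrimeNonUnitalRing S) {a : S} (ha : a ≠ 0) :
    ∃ s, a * s ≠ 0 := by
  by_contra! h
  let I := leftAnnihilatorIdeal (Set.univ : Set S) fun _ _ _ => Set.mem_univ _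
  have haI : a ∈ I := mem_leftAnnihilatorIdeal.2 fun s _ => h s
  have hI : I = ⊥ ∨ (⊤ : TwoSidedIdeal S) = ⊥ := hS.eq_bot_or_eq_bot fun x hx y _ =>
    mem_leftAnnihilatorIdeal.1 hx y (Set.mem_univ y)
  have ha_bot : a ∈ (⊥ : TwoSidedIdeal S) := hI.elim (· ▸ haI) (· ▸ TwoSidedIdeal.mem_top S)
  exact ha ((TwoSidedIdeal.mem_bot S).1 ha_bot)

theorem eq_zero_or_eq_zero (hS : IsPrimeNonUnitalRing S) {a b : S}
    (hab : ∀ s, a * s * b = 0) : a = 0 ∨ b = 0 := by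
  let J := rightAnnihilatorIdeal (Set.range (a * ·)) <| by
    rintro s _ ⟨t, rfl⟩
    exact ⟨t * s, (mul_assoc a t s).symm⟩
  let I := leftAnnihilatorIdeal (J : Set S) fun s _ hy => J.mul_mem_left s _ hy
  have haI (s : S) : a * s ∈ I := mem_leftAnnihilatorIdeal.2 fun y hy =>
    mem_rightAnnihilatorIdeal.1 hy _ ⟨s, rfl⟩
  have hbJ : b ∈ J := mem_rightAnnihilatorIdeal.2 <| by
    rintro _ ⟨s, rfl⟩
    exact hab s
  refine (hS.eq_bot_or_eq_bot fun x hx => mem_leftAnnihilatorIdeal.1 hx).imp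
    (fun hI : I = ⊥ => ?_) fun hJ : J = ⊥ => (TwoSidedIdeal.mem_bot S).1 (hJ ▸ hbJ)
  by_contra ha
  obtain ⟨s, hs⟩ := hS.exists_mul_ne_zero ha
  exact hs ((TwoSidedIdeal.mem_bot S).1 (hI ▸ haI s))

theorem of_eq_zero_or_eq_zero (hS : ∀ a b : S, (∀ s, a * s * b = 0) → a = 0 ∨ b = 0) :
    IsPrimeNonUnitalRing S := by
  rintro ⟨I, J, hI, hJ, hIJ⟩
  have exists_ne_zero (K : TwoSidedIdeal S) (hK : K ≠ ⊥) : ∃ x ∈ K, x ≠ 0 := by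
    by_contra! h
    exact hK (le_bot_iff.1 fun x hx => (TwoSidedIdeal.mem_bot S).2 (h x hx))
  obtain ⟨a, ha, ha0⟩ := exists_ne_zero I hI
  obtain ⟨b, hb, hb0⟩ := exists_ne_zero J hJ
  exact (hS a b fun s => hIJ _ (I.mul_mem_right _ _ ha) _ hb).elim ha0 hb0

theorem exists_mul_mul_ne_zero (hS : IsPrimeNonUnitalRing S) {a : S} (ha : a ≠ 0) :
    ∃ u v, u * a * v ≠ 0 := by
  by_contra! h
  obtain ⟨v, hv⟩ := hS.exists_mul_ne_zero ha
  have hasav (s : S) : a * s * (a * v) = 0 := by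
    rw [← mul_assoc, mul_assoc a, mul_assoc a, h, mul_zero]
  exact (hS.eq_zero_or_eq_zero hasav).elim ha hv

variable {T : Type*} [NonUnitalRing T]

theorem of_injective (hS : IsPrimeNonUnitalRing S) {f : T →ₙ+* S} (hf : Function.Injective f)
    (h : ∀ x y, (∀ t, x * t * y = 0) → ∀ s, f x * s * f y = 0) : IsPrimeNonUnitalRing T :=
  .of_eq_zero_or_eq_zero fun x y hxy => (hS.eq_zero_or_eq_zero (h x y hxy)).imp
    ((map_eq_zero_iff f hf).1 ·) ((map_eq_zero_iff f hf).1 ·)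

theorem of_forall_exists_map_eq (hT : IsPrimeNonUnitalRing T) {f : T →ₙ+* S}
    (hf : Function.Injective f) (h : ∀ x : S, x ≠ 0 → ∃ s t y, y ≠ 0 ∧ f y = s * x * t) :
    IsPrimeNonUnitalRing S := by
  refine .of_eq_zero_or_eq_zero fun a b hab => ?_
  by_contra! hne
  obtain ⟨s, t, x, hx0, hx⟩ := h a hne.1
  obtain ⟨s', t', y, hy0, hy⟩ := h b hne.2
  have hxy (z : T) : x * z * y = 0 := hf <| calc
    f (x * z * y) = s * (a * (t * f z * s') * b) * t' := by
      simp only [map_mul, hx, hy, mul_assoc]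
    _ = f 0 := by rw [hab, mul_zero, zero_mul, map_zero]
  exact (hT.eq_zero_or_eq_zero hxy).elim hx0 hy0

end IsPrimeNonUnitalRing

end PrimeRings

section FCCenter

open scoped Pointwise commutatorElement

variable {H : Type*} [Group H]

/-- The subgroup of all elements with finitely many conjugates, encoded as the elements whose
centralizer has finite index. -/
def fcCenter (H : Type*) [Group H] : Subgroup H where
  carrier := {g | (Subgroup.centralizer {g}).FiniteIndex}
  one_mem' := by
    have : Subgroup.centralizer {(1 : H)} = ⊤ := by
      ext x
      simp [Subgroup.mem_centralizer_singleton_iff]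
    rw [Set.mem_ofPred_eq, this]
    infer_instance
  mul_mem' := by
    intro a b (ha : Subgroup.FiniteIndex _) (hb : Subgroup.FiniteIndex _)
    refine Subgroup.finiteIndex_of_le
      (H := Subgroup.centralizer {a} ⊓ Subgroup.centralizer {b}) fun x ⟨hxa, hxb⟩ => ?_
    exact Subgroup.mem_centralizer_singleton_iff.2 <| Commute.mul_right
      (Subgroup.mem_centralizer_singleton_iff.1 hxa) (Subgroup.mem_centralizer_singleton_iff.1 hxb)
  inv_mem' := by
    intro a (ha : Subgroup.FiniteIndex _)
    refine Subgroup.finiteIndex_of_le (H := Subgroup.centralizer {a}) fun x hx => ?_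
    exact Subgroup.mem_centralizer_singleton_iff.2 <| Commute.inv_right
      (Subgroup.mem_centralizer_singleton_iff.1 hx)

theorem mem_fcCenter_iff_finiteIndex_centralizer {g : H} :
    g ∈ fcCenter H ↔ (Subgroup.centralizer {g}).FiniteIndex :=
  Iff.rfl

theorem mem_fcCenter_iff_finite_conjugatesOf {g : H} :
    g ∈ fcCenter H ↔ (conjugatesOf g).Finite := by
  have hindex : (Subgroup.centralizer {g}).index = (conjugatesOf g).ncard := by
    have horbit : MulAction.orbit (ConjAct H) g = conjugatesOf g := by
      ext h
      exact ConjAct.mem_orbit_conjAct.trans isConj_comm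
    calc (Subgroup.centralizer {g}).index
        = (MulAction.stabilizer (ConjAct H) g).index :=
          (congrArg Subgroup.index (Subgroup.centralizer_eq_comap_stabilizer g)).trans
            (Subgroup.index_comap_of_surjective _ ConjAct.toConjAct.surjective)
      _ = (conjugatesOf g).ncard := by rw [MulAction.index_stabilizer, horbit]
  rw [mem_fcCenter_iff_finiteIndex_centralizer, Subgroup.finiteIndex_iff, hindex]
  exact ⟨Set.finite_of_ncard_ne_zero, fun h => Set.ncard_ne_zero_of_mem mem_conjugatesOf_self h⟩

theorem conjugatesOf_subset_fcCenter {g : H} (hg : g ∈ fcCenter H) :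
    conjugatesOf g ⊆ fcCenter H := fun h (hgh : IsConj g h) => by
  rw [SetLike.mem_coe, mem_fcCenter_iff_finite_conjugatesOf, ← hgh.conjugatesOf_eq]
  exact mem_fcCenter_iff_finite_conjugatesOf.1 hg

theorem fcCenter_eq_top_of_le {K : Subgroup H} (hK : K ≤ fcCenter H) : fcCenter K = ⊤ := by
  refine eq_top_iff.2 fun k _ => ?_
  have := mem_fcCenter_iff_finiteIndex_centralizer.1 (hK k.2)
  refine Subgroup.finiteIndex_of_le (H := (Subgroup.centralizer {(k : H)}).subgroupOf K) ?_
  intro x hx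
  exact Subgroup.mem_centralizer_singleton_iff.2 <| Subtype.ext <|
    Subgroup.mem_centralizer_singleton_iff.1 (Subgroup.mem_subgroupOf.1 hx)

theorem commutatorElement_mul_center (a b : H) (y z : Subgroup.center H) :
    ⁅a * y, b * z⁆ = ⁅a, b⁆ := by
  have hy := Subgroup.mem_center_iff.1 y.2
  have hz := Subgroup.mem_center_iff.1 z.2
  simp only [commutatorElement_def, mul_inv_rev]
  calc a * ↑y * (b * ↑z) * ((↑y)⁻¹ * a⁻¹) * ((↑z)⁻¹ * b⁻¹)
      = a * (y * b) * (z * ((↑y)⁻¹ * a⁻¹)) * ((↑z)⁻¹ * b⁻¹) := by group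
    _ = a * (b * y) * ((↑y)⁻¹ * a⁻¹ * z) * ((↑z)⁻¹ * b⁻¹) := by rw [hy, hz]
    _ = a * b * a⁻¹ * b⁻¹ := by group

theorem finite_commutatorSet_of_finiteIndex_center [(Subgroup.center H).FiniteIndex] :
    Finite (commutatorSet H) := by
  refine ((Set.finite_range fun q : (H ⧸ Subgroup.center H) × (H ⧸ Subgroup.center H) =>
    ⁅q.1.out, q.2.out⁆).subset ?_).to_subtype
  rintro _ ⟨a, b, rfl⟩
  obtain ⟨y, hy⟩ := QuotientGroup.mk_out_eq_mul (Subgroup.center H) a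
  obtain ⟨z, hz⟩ := QuotientGroup.mk_out_eq_mul (Subgroup.center H) b
  exact ⟨(a, b), by simp only [hy, hz, commutatorElement_mul_center]⟩

theorem finite_commutator_of_fcCenter_eq_top [Group.FG H] (hH : fcCenter H = ⊤) :
    Finite (commutator H) := by
  obtain ⟨S, hS⟩ := Group.FG.out (G := H)
  have : (Subgroup.center H).FiniteIndex := by
    rw [Subgroup.center_eq_iInf hS]
    exact Subgroup.finiteIndex_iInf' _ fun g _ =>
      mem_fcCenter_iff_finiteIndex_centralizer.1 (hH ▸ Subgroup.mem_top g)
  have : Finite (commutatorSet H) := finite_commutatorSet_of_finiteIndex_center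
  infer_instance

theorem finite_commutator_closure {S : Set H} (hS : S.Finite) (hSfc : S ⊆ fcCenter H) :
    Finite (commutator (Subgroup.closure S)) := by
  have : Finite S := hS
  exact finite_commutator_of_fcCenter_eq_top
    (fcCenter_eq_top_of_le ((Subgroup.closure_le _).2 hSfc))

theorem isOfFinOrder_commutatorElement {a b : H} (ha : a ∈ fcCenter H) (hb : b ∈ fcCenter H) :
    IsOfFinOrder ⁅a, b⁆ := by
  let K := Subgroup.closure {a, b}
  have : Finite (commutator K) :=
    finite_commutator_closure (Set.toFinite _) (Set.pair_subset ha hb)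
  let a' : K := ⟨a, Subgroup.subset_closure (Set.mem_insert a {b})⟩
  let b' : K := ⟨b, Subgroup.subset_closure (Set.mem_insert_of_mem a rfl)⟩
  let c : commutator K :=
    ⟨⁅a', b'⁆, Subgroup.commutator_mem_commutator (Subgroup.mem_top _) (Subgroup.mem_top _)⟩
  exact (K.subtype.comp (commutator K).subtype).isOfFinOrder (isOfFinOrder_of_finite c)

theorem finite_closure_of_isOfFinOrder {S : Set H} (hS : S.Finite) (hSfc : S ⊆ fcCenter H)
    (ho : ∀ g ∈ S, IsOfFinOrder g) : Finite (Subgroup.closure S) := by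
  let N := Subgroup.closure S
  have : Finite S := hS
  have hcomm : Finite (commutator N) := finite_commutator_closure hS hSfc
  have htorsion : IsMulTorsion (Abelianization N) := by
    have hle : ⊤ ≤ (CommGroup.torsion (Abelianization N)).comap Abelianization.of := by
      rw [← Subgroup.closure_closure_coe_preimage (k := S), Subgroup.closure_le]
      exact fun g hg => Abelianization.of.isOfFinOrder (Submonoid.isOfFinOrder_coe.1 (ho g hg))
    intro x
    obtain ⟨g, rfl⟩ := QuotientGroup.mk_surjective x
    exact hle (Subgroup.mem_top g)
  have : Group.FG (Abelianization N) := QuotientGroup.fg _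
  have : Finite (N ⧸ commutator N) :=
    CommGroup.finite_of_fg_isMulTorsion (Abelianization N) htorsion
  exact (Subgroup.finite_iff_finite_and_finiteIndex (commutator N)).2
    ⟨hcomm, Subgroup.finiteIndex_of_finite_quotient⟩

theorem finite_normalClosure_of_isOfFinOrder {g : H} (hg : g ∈ fcCenter H)
    (ho : IsOfFinOrder g) : Finite (Subgroup.normalClosure {g}) := by
  rw [Subgroup.normalClosure, Group.conjugatesOfSet, Set.biUnion_singleton]
  refine finite_closure_of_isOfFinOrder (mem_fcCenter_iff_finite_conjugatesOf.1 hg)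
    (conjugatesOf_subset_fcCenter hg) fun h (hgh : IsConj g h) => ?_
  obtain ⟨c, rfl⟩ := isConj_iff.1 hgh
  exact (MulAut.conj c).toMonoidHom.isOfFinOrder ho

theorem eq_one_of_mem_fcCenter_of_isOfFinOrder (hH : NoNontrivialFiniteNormalSubgroup H) {g : H}
    (hg : g ∈ fcCenter H) (ho : IsOfFinOrder g) : g = 1 := by
  have hbot := hH _ Subgroup.normalClosure_normal (finite_normalClosure_of_isOfFinOrder hg ho)
  exact Subgroup.mem_bot.1 (hbot ▸ Subgroup.subset_normalClosure (Set.mem_singleton g))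

theorem commute_of_mem_fcCenter (hH : NoNontrivialFiniteNormalSubgroup H) {a b : H}
    (ha : a ∈ fcCenter H) (hb : b ∈ fcCenter H) : Commute a b := by
  have hab : ⁅a, b⁆ ∈ fcCenter H :=
    mul_mem (mul_mem (mul_mem ha hb) (inv_mem ha)) (inv_mem hb)
  exact commutatorElement_eq_one_iff_commute.1
    (eq_one_of_mem_fcCenter_of_isOfFinOrder hH hab (isOfFinOrder_commutatorElement ha hb))

theorem uniqueProds_of_isMulTorsionFree (A : Type*) [CommGroup A] [IsMulTorsionFree A] :
    UniqueProds A := by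
  have : UniqueSums (Additive A) := UniqueSums.of_injective_addHom
    (DivisibleHull.coeAddMonoidHom (M := Additive A)).toAddHom
    DivisibleHull.coe_injective inferInstance
  exact UniqueProds.of_injective_mulHom (G := Multiplicative (Additive A))
    (MulEquiv.refl A).toMulHom (MulEquiv.refl A).injective inferInstance

theorem uniqueProds_fcCenter (hH : NoNontrivialFiniteNormalSubgroup H) :
    UniqueProds (fcCenter H) := by
  let : CommGroup (fcCenter H) :=
    { (inferInstance : Group (fcCenter H)) with
      mul_comm := fun a b => Subtype.ext (commute_of_mem_fcCenter hH a.2 b.2) }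
  have : IsMulTorsionFree (fcCenter H) := IsMulTorsionFree.of_not_isOfFinOrder fun a ha ho =>
    ha (Subtype.ext (eq_one_of_mem_fcCenter_of_isOfFinOrder hH a.2
      ((fcCenter H).subtype.isOfFinOrder ho)))
  exact uniqueProds_of_isMulTorsionFree (fcCenter H)

theorem exists_mem_forall_notMem_leftCoset {ι : Type*} (W : Subgroup H) [W.FiniteIndex]
    (s : Finset ι) (C : ι → Subgroup H) (g : ι → H) (hC : ∀ i ∈ s, ¬(C i).FiniteIndex) :
    ∃ x ∈ W, ∀ i ∈ s, x ∉ g i • (C i : Set H) := by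
  classical
  by_contra! hcon
  have : Fintype (H ⧸ W) := W.fintypeQuotientOfFiniteIndex
  have hcover : ⋃ p ∈ (Finset.univ : Finset (H ⧸ W)) ×ˢ s,
      (p.1.out * g p.2) • (C p.2 : Set H) = Set.univ := by
    refine Set.eq_univ_of_forall fun x => ?_
    have hx : (x : H ⧸ W).out⁻¹ * x ∈ W :=
      QuotientGroup.eq.1 (QuotientGroup.out_eq' (x : H ⧸ W))
    obtain ⟨i, hi, hxi⟩ := hcon _ hx
    refine Set.mem_biUnion (Finset.mk_mem_product (Finset.mem_univ (x : H ⧸ W)) hi) ?_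
    rwa [mul_smul, Set.mem_smul_set_iff_inv_smul_mem]
  obtain ⟨p, hp, hfin⟩ := Subgroup.exists_finiteIndex_of_leftCoset_cover hcover
  exact hC p.2 (Finset.mem_product.1 hp).2 hfin

theorem exists_forall_conj_eq_imp_mem_leftCoset_centralizer (t a : H) :
    ∃ g : H, ∀ x, x * t * x⁻¹ = a → x ∈ g • (Subgroup.centralizer {t} : Set H) := by
  by_cases h : ∃ g, g * t * g⁻¹ = a
  · obtain ⟨g, rfl⟩ := h
    refine ⟨g, fun x hx => ?_⟩
    rw [Set.mem_smul_set_iff_inv_smul_mem, SetLike.mem_coe,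
      Subgroup.mem_centralizer_singleton_iff, smul_eq_mul]
    calc g⁻¹ * x * t = g⁻¹ * (x * t * x⁻¹) * x := by group
      _ = t * (g⁻¹ * x) := by rw [hx]; group
  · exact ⟨1, fun x hx => (h ⟨x, hx⟩).elim⟩

theorem exists_commute_and_conj_notMem (T A : Finset H) :
    ∃ x : H, (∀ t ∈ T, t ∈ fcCenter H → Commute x t) ∧
      ∀ t ∈ T, t ∉ fcCenter H → x * t * x⁻¹ ∉ A := by
  classical
  let W : Subgroup H := ⨅ t ∈ T.filter (· ∈ fcCenter H), Subgroup.centralizer {t}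
  have : W.FiniteIndex := Subgroup.finiteIndex_iInf' _ fun t ht =>
    mem_fcCenter_iff_finiteIndex_centralizer.1 (Finset.mem_filter.1 ht).2
  choose g hg using exists_forall_conj_eq_imp_mem_leftCoset_centralizer (H := H)
  obtain ⟨x, hxW, hx⟩ := exists_mem_forall_notMem_leftCoset W (T.filter (· ∉ fcCenter H) ×ˢ A)
    (fun p => Subgroup.centralizer {p.1}) (fun p => g p.1 p.2)
    fun p hp => (Finset.mem_filter.1 (Finset.mem_product.1 hp).1).2
  refine ⟨x, fun t ht htfc => ?_, fun t ht htfc hxA => ?_⟩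
  · have hxt := Subgroup.mem_iInf.1 (Subgroup.mem_iInf.1 hxW t) (Finset.mem_filter.2 ⟨ht, htfc⟩)
    exact Subgroup.mem_centralizer_singleton_iff.1 hxt
  · exact hx (t, x * t * x⁻¹)
      (Finset.mk_mem_product (Finset.mem_filter.2 ⟨ht, htfc⟩) hxA) (hg _ _ x rfl)

end FCCenter

namespace NonUnitalGroupRing

variable {R : Type w} [NonUnitalRing R] {H : Type v} [Group H]

/-- The coefficient of a group ring element at a group element. -/
noncomputable def coeff (k : H) : NonUnitalGroupRing R H →+ R :=
  Finsupp.applyAddHom k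

/-- The support of a group ring element. -/
noncomputable def supp (x : NonUnitalGroupRing R H) : Finset H :=
  Finsupp.support x

theorem mem_supp {x : NonUnitalGroupRing R H} {k : H} : k ∈ x.supp ↔ coeff k x ≠ 0 :=
  Finsupp.mem_support_iff

theorem ext_coeff {x y : NonUnitalGroupRing R H} (h : ∀ k, coeff k x = coeff k y) : x = y :=
  Finsupp.ext h

theorem ne_zero_of_coeff_ne_zero {x : NonUnitalGroupRing R H} {k : H} (h : coeff k x ≠ 0) :
    x ≠ 0 := by
  rintro rfl
  exact h (map_zero _)

theorem supp_nonempty {x : NonUnitalGroupRing R H} (hx : x ≠ 0) : x.supp.Nonempty :=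
  Finsupp.support_nonempty_iff.2 hx

open Classical in
theorem coeff_single (k h : H) (a : R) : coeff k (single h a) = if h = k then a else 0 :=
  Finsupp.single_apply

theorem single_injective (h : H) : Function.Injective (single h : R → NonUnitalGroupRing R H) :=
  Finsupp.single_injective h

theorem single_left_injective {a : R} (ha : a ≠ 0) :
    Function.Injective fun h : H => single h a :=
  Finsupp.single_left_injective ha

theorem coeff_mul_single (k h : H) (b : R) (x : NonUnitalGroupRing R H) :
    coeff k (x * single h b) = coeff (k * h⁻¹) x * b := by
  classical
  induction x using NonUnitalGroupRing.induction with
  | h0 => simp only [zero_mul, map_zero]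
  | hadd y z hy hz => rw [add_mul, map_add, hy, hz, map_add, add_mul]
  | hs g a => simp only [single_mul_single, coeff_single, eq_mul_inv_iff_mul_eq, ite_mul, zero_mul]

theorem coeff_mul (k : H) (x y : NonUnitalGroupRing R H) :
    coeff k (x * y) = ∑ h ∈ y.supp, coeff (k * h⁻¹) x * coeff h y := by
  have hy : ∑ h ∈ y.supp, single h (coeff h y) = y := Finsupp.sum_single y
  conv_lhs => rw [← hy, Finset.mul_sum, map_sum]
  simp only [coeff_mul_single]

theorem coeff_mul_single_mul (k x : H) (r : R) (α β : NonUnitalGroupRing R H) :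
    coeff k (α * single x r * β) =
      ∑ h ∈ β.supp, coeff (k * h⁻¹ * x⁻¹) α * r * coeff h β := by
  rw [coeff_mul]
  simp only [coeff_mul_single]

theorem mul_mul_eq_zero_of_single {x y : NonUnitalGroupRing R H}
    (h : ∀ g a, x * single g a * y = 0) (s : NonUnitalGroupRing R H) : x * s * y = 0 := by
  induction s using NonUnitalGroupRing.induction with
  | h0 => rw [mul_zero, zero_mul]
  | hadd s t hs ht => rw [mul_add, add_mul, hs, ht, add_zero]
  | hs g a => exact h g a

/-- The embedding `a ↦ a δ_1` of the coefficient ring into the group ring. -/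
noncomputable def singleOneHom (R : Type w) [NonUnitalRing R] (H : Type v) [Group H] :
    R →ₙ+* NonUnitalGroupRing R H where
  toFun := single 1
  map_mul' a b := by rw [single_mul_single, mul_one]
  map_zero' := single_zero 1
  map_add' := single_add 1

theorem isPrime_coefficients (hP : IsPrimeNonUnitalRing (NonUnitalGroupRing R H)) :
    IsPrimeNonUnitalRing R := by
  refine hP.of_injective (f := singleOneHom R H) (single_injective 1) fun a b hab => ?_
  refine mul_mul_eq_zero_of_single fun g t => ?_
  change single 1 a * single g t * single 1 b = 0
  rw [single_mul_single, single_mul_single, hab, single_zero]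

/-- The element `∑ r δ_m`, where `m` runs through the finite subgroup `N`. -/
noncomputable def subgroupSum (N : Subgroup H) [Fintype N] (r : R) : NonUnitalGroupRing R H :=
  ∑ m : N, single (m : H) r

theorem subgroupSum_ne_zero (N : Subgroup H) [Fintype N] {r : R} (hr : r ≠ 0) :
    subgroupSum N r ≠ 0 := by
  classical
  refine ne_zero_of_coeff_ne_zero (k := 1) ?_
  simpa [subgroupSum, coeff_single] using hr

theorem subgroupSum_mul_single_mul_single (N : Subgroup H) [N.Normal] [Fintype N] {n : H}
    (hn : n ∈ N) (g : H) (r t s : R) :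
    subgroupSum N r * single g t * single n s = subgroupSum N r * single g t * single 1 s := by
  have hconj : g * n * g⁻¹ ∈ N := ‹N.Normal›.conj_mem n hn g
  simp only [subgroupSum, Finset.sum_mul, single_mul_single, mul_one]
  refine Fintype.sum_equiv (Equiv.mulRight ⟨g * n * g⁻¹, hconj⟩) _ _ fun m => ?_
  congr 1
  simp only [Equiv.coe_mulRight, Subgroup.coe_mul]
  group

theorem noNontrivialFiniteNormalSubgroup_of_isPrime [Nontrivial R]
    (hP : IsPrimeNonUnitalRing (NonUnitalGroupRing R H)) :
    NoNontrivialFiniteNormalSubgroup H := by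
  intro N _ _
  have := Fintype.ofFinite N
  refine (Subgroup.eq_bot_iff_forall N).2 fun n hn => ?_
  obtain ⟨r, hr⟩ := exists_ne (0 : R)
  have hmul : ∀ s, subgroupSum N r * s * (single n r - single 1 r) = 0 :=
    mul_mul_eq_zero_of_single fun g t => by
      rw [mul_sub, subgroupSum_mul_single_mul_single N hn, sub_self]
  have hdiff : single n r - single 1 r = 0 :=
    (hP.eq_zero_or_eq_zero hmul).resolve_left (subgroupSum_ne_zero N hr)
  exact single_left_injective hr (sub_eq_zero.1 hdiff)

theorem eq_zero_or_eq_zero_of_uniqueProds [UniqueProds H] (hR : IsPrimeNonUnitalRing R)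
    {α β : NonUnitalGroupRing R H} (hαβ : ∀ r, α * single 1 r * β = 0) : α = 0 ∨ β = 0 := by
  by_contra! hne
  obtain ⟨a, ha, b, hb, hab⟩ :=
    UniqueProds.uniqueMul_of_nonempty (supp_nonempty hne.1) (supp_nonempty hne.2)
  have hcoeff (r : R) : coeff a α * r * coeff b β = 0 := by
    have h0 : coeff (a * b) (α * single 1 r * β) = 0 := by rw [hαβ, map_zero]
    rw [coeff_mul_single_mul, Finset.sum_eq_single_of_mem b hb] at h0
    · rwa [inv_one, mul_one, mul_inv_cancel_right] at h0
    · intro h hh hhb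
      rw [inv_one, mul_one]
      by_contra hnz
      have hmem : a * b * h⁻¹ ∈ α.supp := mem_supp.2 fun h0 => hnz (by rw [h0, zero_mul, zero_mul])
      exact hhb (hab hmem hh (inv_mul_cancel_right _ _)).2
  exact (hR.eq_zero_or_eq_zero hcoeff).elim (mem_supp.1 ha) (mem_supp.1 hb)

section CosetParts

variable {K : Type*} [Group K]

/-- The element `∑ x_{f k} δ_k` obtained by pulling back the coefficients of `x` along `f`, which
need not be a homomorphism. -/
noncomputable def comap (f : K ↪ H) (x : NonUnitalGroupRing R H) : NonUnitalGroupRing R K :=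
  Finsupp.comapDomain f x f.injective.injOn

theorem coeff_comap (f : K ↪ H) (x : NonUnitalGroupRing R H) (k : K) :
    coeff k (comap f x) = coeff (f k) x :=
  Finsupp.comapDomain_apply f x f.injective.injOn k

theorem sum_supp_comap {M : Type*} [AddCommMonoid M] (f : K ↪ H) (x : NonUnitalGroupRing R H)
    {F : H → M} (hF : ∀ h ∈ x.supp, h ∉ Set.range f → F h = 0) :
    ∑ k ∈ (comap f x).supp, F (f k) = ∑ h ∈ x.supp, F h :=
  Finset.sum_preimage f x.supp f.injective.injOn F hF

/-- The part of `x` supported on the left coset `a L`, translated to `L`. -/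
noncomputable def leftCosetPart (L : Subgroup H) (a : H) (x : NonUnitalGroupRing R H) :
    NonUnitalGroupRing R L :=
  comap ((Function.Embedding.subtype (· ∈ L)).trans (mulLeftEmbedding a)) x

/-- The part of `x` supported on the right coset `L b`, translated to `L`. -/
noncomputable def rightCosetPart (L : Subgroup H) (b : H) (x : NonUnitalGroupRing R H) :
    NonUnitalGroupRing R L :=
  comap ((Function.Embedding.subtype (· ∈ L)).trans (mulRightEmbedding b)) x

theorem coeff_leftCosetPart (L : Subgroup H) (a : H) (x : NonUnitalGroupRing R H) (k : L) :
    coeff k (leftCosetPart L a x) = coeff (a * k) x :=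
  coeff_comap ..

theorem coeff_rightCosetPart (L : Subgroup H) (b : H) (x : NonUnitalGroupRing R H) (k : L) :
    coeff k (rightCosetPart L b x) = coeff (k * b) x :=
  coeff_comap ..

theorem leftCosetPart_ne_zero {L : Subgroup H} {a : H} {x : NonUnitalGroupRing R H}
    (ha : a ∈ x.supp) : leftCosetPart L a x ≠ 0 :=
  ne_zero_of_coeff_ne_zero (k := 1) <| by
    rw [coeff_leftCosetPart, Subgroup.coe_one, mul_one]
    exact mem_supp.1 ha

theorem rightCosetPart_ne_zero {L : Subgroup H} {b : H} {x : NonUnitalGroupRing R H}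
    (hb : b ∈ x.supp) : rightCosetPart L b x ≠ 0 :=
  ne_zero_of_coeff_ne_zero (k := 1) <| by
    rw [coeff_rightCosetPart, Subgroup.coe_one, one_mul]
    exact mem_supp.1 hb

theorem sum_supp_rightCosetPart {M : Type*} [AddCommMonoid M] (L : Subgroup H) (b : H)
    (x : NonUnitalGroupRing R H) {F : H → M} (hF : ∀ h ∈ x.supp, h * b⁻¹ ∉ L → F h = 0) :
    ∑ k ∈ (rightCosetPart L b x).supp, F (k * b) = ∑ h ∈ x.supp, F h := by
  refine sum_supp_comap _ x fun h hh hrange => hF h hh fun hL => hrange ⟨⟨h * b⁻¹, hL⟩, ?_⟩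
  exact inv_mul_cancel_right h b

end CosetParts

theorem exists_forall_coeff_mul_conj (α : NonUnitalGroupRing R H) (a : H) (T : Finset H) :
    ∃ x : H, ∀ t ∈ T,
      (t ∈ fcCenter H → coeff (a * (x * t * x⁻¹)) α = coeff (a * t) α) ∧
        (t ∉ fcCenter H → coeff (a * (x * t * x⁻¹)) α = 0) := by
  classical
  obtain ⟨x, hcomm, hconj⟩ := exists_commute_and_conj_notMem T (α.supp.image (a⁻¹ * ·))
  refine ⟨x, fun t ht => ⟨fun htfc => ?_, fun htfc => ?_⟩⟩
  · rw [(hcomm t ht htfc).eq, mul_inv_cancel_right]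
  · by_contra hne
    exact hconj t ht htfc (Finset.mem_image.2 ⟨_, mem_supp.2 hne, inv_mul_cancel_left _ _⟩)

theorem leftCosetPart_mul_single_one_mul_rightCosetPart {α β : NonUnitalGroupRing R H}
    (hαβ : ∀ s, α * s * β = 0) (a b : H) (r : R) :
    leftCosetPart (fcCenter H) a α * single 1 r * rightCosetPart (fcCenter H) b β = 0 := by
  classical
  refine ext_coeff fun k => ?_
  -- `α · r δ_x · β` has coefficient `∑ h, F h` at `a x k b`: its terms with `h ∉ Δ b` vanish, and
  -- `x` drops out of the others.
  obtain ⟨x, hx⟩ := exists_forall_coeff_mul_conj α a (β.supp.image fun h => k * b * h⁻¹)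
  let F (h : H) : R := coeff (a * (x * (k * b * h⁻¹) * x⁻¹)) α * r * coeff h β
  calc coeff k (leftCosetPart (fcCenter H) a α * single 1 r * rightCosetPart (fcCenter H) b β)
      = ∑ h ∈ (rightCosetPart (fcCenter H) b β).supp, F (h * b) := by
        rw [coeff_mul_single_mul]
        refine Finset.sum_congr rfl fun h hh => ?_
        have hhb : (h : H) * b ∈ β.supp :=
          mem_supp.2 (coeff_rightCosetPart _ b β h ▸ mem_supp.1 hh)
        have hkh : (k : H) * b * (h * b)⁻¹ = ↑(k * h⁻¹) := by
          push_cast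
          group
        simp only [F]
        rw [(hx _ (Finset.mem_image_of_mem _ hhb)).1 (hkh ▸ (k * h⁻¹).2), hkh,
          coeff_leftCosetPart, coeff_rightCosetPart, inv_one, mul_one]
    _ = ∑ h ∈ β.supp, F h := by
        refine sum_supp_rightCosetPart _ b β fun h hh hhb => ?_
        have hkh : k * b * h⁻¹ ∉ fcCenter H := by
          rwa [mul_assoc, mul_mem_cancel_left k.2, ← inv_mem_iff, mul_inv_rev, inv_inv]
        simp only [F, (hx _ (Finset.mem_image_of_mem _ hh)).2 hkh, zero_mul]
    _ = coeff (a * x * k * b) (α * single x r * β) := by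
        rw [coeff_mul_single_mul]
        simp only [F, mul_assoc]
    _ = coeff k 0 := by rw [hαβ, map_zero, map_zero]

theorem isPrime_of_noNontrivialFiniteNormalSubgroup (hR : IsPrimeNonUnitalRing R)
    (hH : NoNontrivialFiniteNormalSubgroup H) : IsPrimeNonUnitalRing (NonUnitalGroupRing R H) := by
  have := uniqueProds_fcCenter hH
  refine .of_eq_zero_or_eq_zero fun α β hαβ => ?_
  by_contra! hne
  obtain ⟨a, ha⟩ := supp_nonempty hne.1
  obtain ⟨b, hb⟩ := supp_nonempty hne.2
  exact (eq_zero_or_eq_zero_of_uniqueProds hR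
    (leftCosetPart_mul_single_one_mul_rightCosetPart hαβ a b)).elim
    (leftCosetPart_ne_zero ha) (rightCosetPart_ne_zero hb)

theorem isPrime_iff [Nontrivial R] :
    IsPrimeNonUnitalRing (NonUnitalGroupRing R H) ↔
      IsPrimeNonUnitalRing R ∧ NoNontrivialFiniteNormalSubgroup H :=
  ⟨fun h => ⟨isPrime_coefficients h, noNontrivialFiniteNormalSubgroup_of_isPrime h⟩,
    fun h => isPrime_of_noNontrivialFiniteNormalSubgroup h.1 h.2⟩

end NonUnitalGroupRing

namespace GroupoidRing

variable {R : Type w} [NonUnitalRing R] {G : Type u} [Groupoid.{v} G]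

/-- The coefficient of a groupoid ring element at a morphism. -/
noncomputable def coeff (g : GroupoidMor G) : GroupoidRing R G →+ R :=
  Finsupp.applyAddHom g

theorem exists_coeff_ne_zero {x : GroupoidRing R G} (hx : x ≠ 0) : ∃ g, coeff g x ≠ 0 := by
  by_contra! h
  exact hx (Finsupp.ext h)

open Classical in
theorem coeff_single (k g : GroupoidMor G) (a : R) :
    coeff k (single g a) = if g = k then a else 0 :=
  Finsupp.single_apply

theorem single_ne_zero {g : GroupoidMor G} {a : R} (ha : a ≠ 0) : single g a ≠ 0 :=
  Finsupp.single_ne_zero.2 ha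

theorem single_mul_single_comp {a b c : G} (g : a ⟶ b) (h : b ⟶ c) (x y : R) :
    single ⟨b, c, h⟩ x * single ⟨a, b, g⟩ y = single ⟨a, c, g ≫ h⟩ (x * y) := by
  rw [single_mul_single_of_eq _ _ rfl, GroupoidMor.comp, eqToHom_refl, Category.id_comp]

theorem mul_mul_eq_zero_of_single {x y : GroupoidRing R G}
    (h : ∀ g a, x * single g a * y = 0) (s : GroupoidRing R G) : x * s * y = 0 := by
  induction s using GroupoidRing.induction with
  | h0 => rw [mul_zero, zero_mul]
  | hadd s t hs ht => rw [mul_add, add_mul, hs, ht, add_zero]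
  | hs g a => exact h g a

/-- The embedding of the group ring of an isotropy group into the groupoid ring. -/
noncomputable def isotropyHom (R : Type w) [NonUnitalRing R] (e : G) :
    NonUnitalGroupRing R (Isotropy e) →ₙ+* GroupoidRing R G :=
  let f : NonUnitalGroupRing R (Isotropy e) →+ GroupoidRing R G :=
    Finsupp.mapDomain.addMonoidHom fun h : Isotropy e => ⟨e, e, h⟩
  have f_single (h : Isotropy e) (a : R) :
      f (NonUnitalGroupRing.single h a) = single ⟨e, e, h⟩ a := Finsupp.mapDomain_single
  { f with
    map_mul' := fun x y => by
      change f (x * y) = f x * f y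
      induction x using NonUnitalGroupRing.induction with
      | h0 => simp only [zero_mul, map_zero]
      | hadd x x' hx hx' => simp only [add_mul, map_add, hx, hx']
      | hs g a =>
      induction y using NonUnitalGroupRing.induction with
      | h0 => simp only [mul_zero, map_zero]
      | hadd y y' hy hy' => simp only [mul_add, map_add, hy, hy']
      | hs h b =>
        simp only [NonUnitalGroupRing.single_mul_single, f_single, single_mul_single_comp,
          End.mul_def] }

theorem isotropyHom_single (e : G) (h : Isotropy e) (a : R) :
    isotropyHom R e (NonUnitalGroupRing.single h a) = single ⟨e, e, h⟩ a :=
  Finsupp.mapDomain_single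

theorem isotropyHom_injective (e : G) : Function.Injective (isotropyHom R e) :=
  Finsupp.mapDomain_injective fun _ _ h => by simpa using h

theorem isotropyHom_mul_single_of_ne {e : G} (x : NonUnitalGroupRing R (Isotropy e))
    {g : GroupoidMor G} (hg : e ≠ g.r) (a : R) : isotropyHom R e x * single g a = 0 := by
  induction x using NonUnitalGroupRing.induction with
  | h0 => rw [map_zero, zero_mul]
  | hadd x x' hx hx' => rw [map_add, add_mul, hx, hx', add_zero]
  | hs h b => rw [isotropyHom_single, single_mul_single_of_ne _ _ hg]

theorem single_mul_isotropyHom_of_ne {e : G} (x : NonUnitalGroupRing R (Isotropy e))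
    {g : GroupoidMor G} (hg : g.s ≠ e) (a : R) : single g a * isotropyHom R e x = 0 := by
  induction x using NonUnitalGroupRing.induction with
  | h0 => rw [map_zero, mul_zero]
  | hadd x x' hx hx' => rw [map_add, mul_add, hx, hx', add_zero]
  | hs h b => rw [isotropyHom_single, single_mul_single_of_ne _ _ hg]

theorem isPrime_isotropy (hP : IsPrimeNonUnitalRing (GroupoidRing R G)) (e : G) :
    IsPrimeNonUnitalRing (NonUnitalGroupRing R (Isotropy e)) := by
  refine hP.of_injective (isotropyHom_injective e) fun x y hxy => ?_
  refine mul_mul_eq_zero_of_single fun ⟨s, r, g⟩ a => ?_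
  obtain rfl | hr := eq_or_ne e r
  · obtain rfl | hs := eq_or_ne s e
    · rw [← isotropyHom_single, ← map_mul, ← map_mul, hxy, map_zero]
    · rw [mul_assoc, single_mul_isotropyHom_of_ne y hs, mul_zero]
  · rw [isotropyHom_mul_single_of_ne x hr, zero_mul]

theorem connected_of_isPrime [Nontrivial R] (hP : IsPrimeNonUnitalRing (GroupoidRing R G)) :
    GroupoidConnected G := by
  intro e f
  by_contra hef
  obtain ⟨a, ha⟩ := exists_ne (0 : R)
  have hzero : ∀ s : GroupoidRing R G, single ⟨f, f, 𝟙 f⟩ a * s * single ⟨e, e, 𝟙 e⟩ a = 0 := by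
    refine mul_mul_eq_zero_of_single fun ⟨s, r, g⟩ b => ?_
    obtain rfl | hr := eq_or_ne f r
    · have hs : s ≠ e := by
        rintro rfl
        exact hef ⟨g⟩
      rw [mul_assoc, single_mul_single_of_ne _ _ hs, mul_zero]
    · rw [single_mul_single_of_ne _ _ hr, zero_mul]
  exact (hP.eq_zero_or_eq_zero hzero).elim (single_ne_zero ha) (single_ne_zero ha)

theorem single_mul_mul_single_mem_range {e f f' : G} (p : f ⟶ e) (q : e ⟶ f') (a b : R)
    (x : GroupoidRing R G) :
    single ⟨f, e, p⟩ a * x * single ⟨e, f', q⟩ b ∈ (isotropyHom R e).range := by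
  induction x using GroupoidRing.induction with
  | h0 => simp only [mul_zero, zero_mul, zero_mem]
  | hadd x x' hx hx' => simpa only [mul_add, add_mul] using add_mem hx hx'
  | hs g c =>
    obtain ⟨s, r, g⟩ := g
    obtain rfl | hr := eq_or_ne f r
    · obtain rfl | hs := eq_or_ne s f'
      · rw [single_mul_single_comp, single_mul_single_comp]
        exact ⟨_, isotropyHom_single ..⟩
      · rw [mul_assoc, single_mul_single_of_ne _ _ hs, mul_zero]
        exact zero_mem _
    · rw [single_mul_single_of_ne _ _ hr, zero_mul]
      exact zero_mem _

theorem coeff_single_mul_mul_single {e e' f f' : G} (p : f ⟶ e) (g : f' ⟶ f) (q : e' ⟶ f')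
    (a b : R) (x : GroupoidRing R G) :
    coeff ⟨e', e, q ≫ g ≫ p⟩ (single ⟨f, e, p⟩ a * x * single ⟨e', f', q⟩ b) =
      a * coeff ⟨f', f, g⟩ x * b := by
  classical
  induction x using GroupoidRing.induction with
  | h0 => simp only [mul_zero, zero_mul, map_zero]
  | hadd x x' hx hx' => simp only [mul_add, add_mul, map_add, hx, hx']
  | hs k c =>
    obtain ⟨s, r, k⟩ := k
    obtain rfl | hr := eq_or_ne f r
    · obtain rfl | hs := eq_or_ne s f'
      · simp only [single_mul_single_comp, coeff_single, GroupoidMor.mk.injEq, heq_eq_eq, true_and,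
          cancel_epi, cancel_mono, mul_ite, ite_mul, mul_zero, zero_mul]
      · rw [mul_assoc, single_mul_single_of_ne _ _ hs, coeff_single, if_neg]
        · simp only [mul_zero, zero_mul, map_zero]
        · exact fun h => hs (congrArg GroupoidMor.s h)
    · rw [single_mul_single_of_ne _ _ hr, coeff_single, if_neg]
      · simp only [mul_zero, zero_mul, map_zero]
      · exact fun h => hr (congrArg GroupoidMor.r h).symm

theorem isPrime_of_isPrime_isotropy (hG : GroupoidConnected G) {e : G}
    (hP : IsPrimeNonUnitalRing (NonUnitalGroupRing R (Isotropy e))) :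
    IsPrimeNonUnitalRing (GroupoidRing R G) := by
  refine hP.of_forall_exists_map_eq (isotropyHom_injective e) fun x hx => ?_
  obtain ⟨⟨s, r, g⟩, hg⟩ := exists_coeff_ne_zero hx
  obtain ⟨p⟩ := hG r e
  obtain ⟨q⟩ := hG e s
  obtain ⟨u, v, huv⟩ := (NonUnitalGroupRing.isPrime_coefficients hP).exists_mul_mul_ne_zero hg
  obtain ⟨y, hy⟩ := single_mul_mul_single_mem_range p q u v x
  refine ⟨_, _, y, ?_, hy⟩
  rintro rfl
  apply huv
  rw [← coeff_single_mul_mul_single p g q, ← hy, map_zero, map_zero]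

end GroupoidRing

theorem mainTheorem8_general {R : Type w} [NonUnitalRing R] [Nontrivial R]
    {G : Type u} [Groupoid.{v} G] [Nonempty G] :
    List.TFAE [
      IsPrimeNonUnitalRing (GroupoidRing R G),
      GroupoidConnected G ∧
        ∃ e : G, IsPrimeNonUnitalRing (NonUnitalGroupRing R (Isotropy e)),
      GroupoidConnected G ∧
        ∀ e : G, IsPrimeNonUnitalRing (NonUnitalGroupRing R (Isotropy e)),
      GroupoidConnected G ∧ IsPrimeNonUnitalRing R ∧
        ∃ e : G, NoNontrivialFiniteNormalSubgroup (Isotropy e),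
      GroupoidConnected G ∧ IsPrimeNonUnitalRing R ∧
        ∀ e : G, NoNontrivialFiniteNormalSubgroup (Isotropy e)] := by
  tfae_have 1 → 3 := fun h => ⟨GroupoidRing.connected_of_isPrime h, GroupoidRing.isPrime_isotropy h⟩
  tfae_have 3 → 2 := fun ⟨hG, h⟩ => ⟨hG, ‹Nonempty G›.elim fun e => ⟨e, h e⟩⟩
  tfae_have 2 → 1 := fun ⟨hG, _, h⟩ => GroupoidRing.isPrime_of_isPrime_isotropy hG h
  tfae_have 2 ↔ 4 := by
    simp only [NonUnitalGroupRing.isPrime_iff, exists_and_left]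
  tfae_have 3 ↔ 5 := by
    simp only [NonUnitalGroupRing.isPrime_iff, forall_and, forall_const]
  tfae_finish

theorem mainTheorem8 {R : Type w} [NonUnitalRing R] [Nontrivial R] (hR : IsSUnitalRing R)
    {G : Type u} [Groupoid.{v} G] [Nonempty G] :
    List.TFAE [
      IsPrimeNonUnitalRing (GroupoidRing R G),
      GroupoidConnected G ∧
        ∃ e : G, IsPrimeNonUnitalRing (NonUnitalGroupRing R (Isotropy e)),
      GroupoidConnected G ∧
        ∀ e : G, IsPrimeNonUnitalRing (NonUnitalGroupRing R (Isotropy e)),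
      GroupoidConnected G ∧ IsPrimeNonUnitalRing R ∧
        ∃ e : G, NoNontrivialFiniteNormalSubgroup (Isotropy e),
      GroupoidConnected G ∧ IsPrimeNonUnitalRing R ∧
        ∀ e : G, NoNontrivialFiniteNormalSubgroup (Isotropy e)] :=
  mainTheorem8_general
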